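/- **Setting.** Fix $d\ge 1$ and $x_0\in\mathbb R^d$ (Euclidean norm). Let $\mathcal F_{H,R,\Delta}$ be the class of all differentiable convex $F:\mathbb R^d\to\mathbb R$ that are $H$-smooth, i.e. $F(y)\le F(x)+\langle\nabla F(x),y-x\rangle+\frac H2\|y-x\|^2$ for all $x,y$, that have a minimizer $x^*$ with $\|x_0-x^*\|\le R$ (domain-bounded), and that satisfy $F(x_0)-\min F\le\Delta$ (range-bounded). A *stochastic global oracle* for $F$ with variance bound $\sigma^2$ consists of a probability space $(\mathcal Z,\mathcal D)$ and a function $f:\mathbb R^d\times\mathcal Z\to\mathbb R$, each component $f(\cdot;z)$ being differentiable, with $F(x)=\mathbb E_{z\sim\mathcal D}f(x;z)$ and $\mathbb E_{z\sim\mathcal D}\|\nabla f(x;z)-\nabla F(x)\|^2\le\sigma^2$ for every $x$; each query draws an independent $z\sim\mathcal D$ and returns the whole function $f(\cdot;z)$. A deterministic algorithm is a map $A$ from finite lists of oracle answers to $\mathbb R^d$, with iterates $\hat x_t=A(O_0,\dots,O_{t-1})$ for $t\ge0$, where $O_s$ is the oracle's answer to the query $\hat x_s$ (a global oracle ignores the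 query point; $\hat x_0$ need not be $x_0$); a randomized algorithm is a random choice of such a map, independent of the oracle. For a class $\mathfrak O$ of oracles, the sample complexity $m_\epsilon(\mathcal F,\mathfrak O)$ of finding an $\epsilon$-stationary point is the least $m\in\mathbb N$ (or $\infty$) such that $$\inf_A\ \sup_{F\in\mathcal F,\ O\in\mathfrak O\text{ an oracle for }F}\ \mathbb E\|\nabla F(\hat x_m)\|\le\epsilon ,$$ the expectation being over the oracle's draws and the algorithm's randomness, if any. **Theorem.** There is an absolute constant $c>0$ such that for all $d\ge1$, $x_0\in\mathbb R^d$, $H,\Delta,R,\sigma>0$ and all $0<\epsilon\le\min\{\frac{HR}{8},\sqrt{\frac{H\Delta}{8}},\frac{\sigma}{4}\}$, $$m_\epsilon(\mathcal F_{H,R,\Delta},\mathfrak O)\ \ge\ c\,\frac{\sigma^2}{\epsilon^2},$$ both when the infimum is over deterministic algorithms and when it is over randomized algorithms, and both when $\mathfrak O$ consists of all stochastic global oracles with variance bound $\sigma^2$ and when $\mathfrak O$ consists only of those all of whose components $f(\cdot;z)$ are convex. -/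

import Mathlib

open MeasureTheory
open scoped ENNReal

universe u

noncomputable section

namespace StochOpt

/-! ### Function classes -/

section Classes

variable {E : Type*} [NormedAddCommGroup E] [InnerProductSpace ℝ E] [CompleteSpace E]

/-- `F` is differentiable and `F y ≤ F x + ⟨∇F x, y - x⟩ + (H/2) ‖y - x‖²` for all `x, y`. -/
def IsSmooth (H : ℝ) (F : E → ℝ) : Prop :=
  Differentiable ℝ F ∧
    ∀ x y : E, F y ≤ F x + inner ℝ (gradient F x) (y - x) + H / 2 * ‖y - x‖ ^ 2

/-- `F` is differentiable and `F y ≥ F x + ⟨∇F x, y - x⟩ + (l/2) ‖y - x‖²` for all `x, y`;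
for `l = 0` this is convexity. -/
def IsStronglyConvex (l : ℝ) (F : E → ℝ) : Prop :=
  Differentiable ℝ F ∧
    ∀ x y : E, F x + inner ℝ (gradient F x) (y - x) + l / 2 * ‖y - x‖ ^ 2 ≤ F y

/-- Domain-bounded functions: `H`-smooth, `l`-strongly convex, with a minimizer at distance at
most `R` from `x₀`. -/
def domainBounded (H l R : ℝ) (x₀ : E) : Set (E → ℝ) :=
  {F | IsSmooth H F ∧ IsStronglyConvex l F ∧ ∃ xs : E, (∀ y, F xs ≤ F y) ∧ ‖x₀ - xs‖ ≤ R}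

/-- Range-bounded functions: `H`-smooth, `l`-strongly convex, attaining their minimum, with
`F x₀ - min F ≤ Δ`. -/
def rangeBounded (H l Δ : ℝ) (x₀ : E) : Set (E → ℝ) :=
  {F | IsSmooth H F ∧ IsStronglyConvex l F ∧ ∃ xs : E, (∀ y, F xs ≤ F y) ∧ F x₀ - F xs ≤ Δ}

end Classes

/-! ### Oracles -/

/-- A stochastic oracle on `E` with information space `I`: on a query `x` it draws a fresh
`z ∼ D` and returns `answer x z`. -/
structure StochasticOracle (E : Type*) (I : Type*) where
  Z : Type
  [instMeasurableSpace : MeasurableSpace Z]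
  D : Measure Z
  [instIsProbabilityMeasure : IsProbabilityMeasure D]
  answer : E → Z → I

attribute [instance] StochasticOracle.instMeasurableSpace
  StochasticOracle.instIsProbabilityMeasure

section Oracles

variable {E : Type*} [NormedAddCommGroup E] [InnerProductSpace ℝ E] [CompleteSpace E]

/-- The stochastic global oracles for `F` with variance bound `σ²`: they are given by components
`f(·; z)` with `F x = 𝔼_z f(x; z)` and `𝔼_z ‖∇f(x; z) - ∇F x‖² ≤ σ²` for every `x`; the query
point is ignored and the whole function `f(·; z)` is returned. -/
def globalOracles (σ : ℝ) (F : E → ℝ) : Set (StochasticOracle E (E → ℝ)) :=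
  {O | ∃ f : E → O.Z → ℝ,
    (∀ z, Differentiable ℝ fun x => f x z) ∧
    (∀ x, Measurable (f x)) ∧
    (∀ x, Integrable (f x) O.D) ∧
    (∀ x, F x = ∫ z, f x z ∂O.D) ∧
    (∀ x, ∫⁻ z, ‖gradient (fun y => f y z) x - gradient F x‖ₑ ^ 2 ∂O.D
      ≤ ENNReal.ofReal (σ ^ 2)) ∧
    ∀ q z, O.answer q z = fun x => f x z}

/-- The stochastic global oracles all of whose components `f(·; z)` are convex. -/
def convexGlobalOracles (σ : ℝ) (F : E → ℝ) : Set (StochasticOracle E (E → ℝ)) :=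
  {O | O ∈ globalOracles σ F ∧ ∀ q z, ConvexOn ℝ Set.univ (O.answer q z)}

end Oracles

/-! ### Algorithms and minimax oracle complexity -/

section Complexity

variable {E I : Type*}

/-- The list of answers received by the algorithm `A`, run against the oracle `O` when the draws
are `zs`: the next query is always `A` applied to the answers received so far. -/
def transcript (A : List I → E) (O : StochasticOracle E I) (zs : List O.Z) : List I :=
  zs.foldl (fun h z => h ++ [O.answer (A h) z]) []

/-- The iterate `x_m = A(O(x_0), …, O(x_{m-1}))`, where `z` lists the `m` draws of the oracle. -/
def iterate (A : List I → E) (O : StochasticOracle E I) {m : ℕ} (z : Fin m → O.Z) : E :=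
  A (transcript A O (List.ofFn z))

/-- A randomized algorithm: a random seed `ω ∼ P`, drawn independently of the oracle, selects a
deterministic algorithm. The point chosen after any fixed list of answers is a random variable;
no measurability in the answers is imposed. -/
structure RandomizedAlgorithm (E : Type*) [MeasurableSpace E] (I : Type*) where
  Ω : Type u
  [instMeasurableSpace : MeasurableSpace Ω]
  P : Measure Ω
  [instIsProbabilityMeasure : IsProbabilityMeasure P]
  alg : Ω → List I → E
  measurable_alg : ∀ h : List I, Measurable fun ω => alg ω h

attribute [instance] RandomizedAlgorithm.instMeasurableSpace
  RandomizedAlgorithm.instIsProbabilityMeasure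

variable [NormedAddCommGroup E] [InnerProductSpace ℝ E] [CompleteSpace E] [MeasurableSpace E]

/-- `𝔼 ‖∇F(x_m)‖` for a deterministic algorithm (the `m` draws are i.i.d. from `O.D`). -/
def expectedGradNorm (A : List I → E) (O : StochasticOracle E I) (F : E → ℝ) (m : ℕ) : ℝ≥0∞ :=
  ∫⁻ z : Fin m → O.Z, ‖gradient F (iterate A O z)‖ₑ ∂(Measure.pi fun _ => O.D)

/-- `𝔼 ‖∇F(x_m)‖` for a randomized algorithm, over the seed and the `m` draws of the oracle. -/
def randomizedExpectedGradNorm (A : RandomizedAlgorithm.{u} E I) (O : StochasticOracle E I)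
    (F : E → ℝ) (m : ℕ) : ℝ≥0∞ :=
  ∫⁻ p : A.Ω × (Fin m → O.Z), ‖gradient F (iterate (A.alg p.1) O p.2)‖ₑ
    ∂(A.P.prod (Measure.pi fun _ => O.D))

/-- Minimax oracle complexity of finding an `ε`-stationary point of `F ∈ 𝓕`, where `F` may be
accessed through any oracle in `𝓞 F`: the least `m` with
`inf_A sup_{F, O} 𝔼 ‖∇F(x_m)‖ ≤ ε` (and `⊤` if there is none). -/
def complexity (𝓕 : Set (E → ℝ)) (𝓞 : (E → ℝ) → Set (StochasticOracle E I)) (ε : ℝ) : ℕ∞ :=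
  ⨅ (m : ℕ) (_ : (⨅ A : List I → E, ⨆ F ∈ 𝓕, ⨆ O ∈ 𝓞 F, expectedGradNorm A O F m)
    ≤ ENNReal.ofReal ε), (m : ℕ∞)

/-- The same minimax oracle complexity, with the infimum over randomized algorithms. -/
def randomizedComplexity (𝓕 : Set (E → ℝ)) (𝓞 : (E → ℝ) → Set (StochasticOracle E I))
    (ε : ℝ) : ℕ∞ :=
  ⨅ (m : ℕ) (_ : (⨅ A : RandomizedAlgorithm.{u} E I, ⨆ F ∈ 𝓕, ⨆ O ∈ 𝓞 F,
    randomizedExpectedGradNorm A O F m) ≤ ENNReal.ofReal ε), (m : ℕ∞)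

end Complexity

end StochOpt

end

/-! Two-point method. Take the quadratics with Hessian `H` centred at `x₀` and linear parts `±δ •
v`, where `‖v‖ = σ` and `δ = 4ε/σ`. Their gradients differ everywhere by a vector of norm `8ε`, so
no point is nearly stationary for both. Each has an oracle that returns the quadratic with linear
part `v` or `-v` by the flip of a coin of bias `±δ`. Both oracles give the same two answers, so only
the law of the flips identifies the instance.

The laws of `m` flips overlap by at least `(1 - m δ²) / 2` (`sum_min_coinsWeight_ge`). On this
overlap an algorithm outputs the same point for both instances, so its two risks sum to at least `(1
- m δ²) · 4ε` (`expectedGradNorm_add_ge`). If both are at most `ε`, then `m ≥ 1 / (2δ²) = σ² / (32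
ε²)`. Averaging over the seed extends this to randomized algorithms, and the components are convex
anyway. -/

noncomputable section

namespace StochOpt

/-! ### Quadratic functions -/

section Quadratic

variable {E : Type*} [NormedAddCommGroup E] [InnerProductSpace ℝ E]

/-- The quadratic function `x ↦ (H/2) ‖x - x₀‖² + ⟨v, x - x₀⟩`. -/
def quadratic (H : ℝ) (x₀ v x : E) : ℝ :=
  H / 2 * ‖x - x₀‖ ^ 2 + inner ℝ v (x - x₀)

/-- The second-order expansion is exact; smoothness, convexity and the minimizer are all read off
from it. -/
theorem quadratic_expansion (H : ℝ) (x₀ v x y : E) :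
    quadratic H x₀ v y = quadratic H x₀ v x + inner ℝ (H • (x - x₀) + v) (y - x)
      + H / 2 * ‖y - x‖ ^ 2 := by
  have h : y - x₀ = (x - x₀) + (y - x) := by abel
  unfold quadratic
  rw [h, norm_add_sq_real, inner_add_left, inner_add_right, real_inner_smul_left]
  ring

theorem convexOn_quadratic {H : ℝ} (hH : 0 ≤ H) (x₀ v : E) :
    ConvexOn ℝ Set.univ (quadratic H x₀ v) := by
  have h₁ : ConvexOn ℝ Set.univ fun x : E => H / 2 * dist x x₀ ^ 2 :=
    ((convexOn_dist x₀ convex_univ).pow (fun _ _ => dist_nonneg) 2).smul (by positivity)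
  have h₂ : ConvexOn ℝ Set.univ fun x : E => inner ℝ v x + -inner ℝ v x₀ :=
    ((innerSL ℝ v).toLinearMap.convexOn convex_univ).add (convexOn_const _ convex_univ)
  refine (h₁.add h₂).congr fun x _ => ?_
  simp [quadratic, dist_eq_norm, inner_sub_right, ← sub_eq_add_neg]

theorem quadratic_minimizer_le {H : ℝ} (hH : 0 < H) (x₀ v y : E) :
    quadratic H x₀ v (x₀ - H⁻¹ • v) ≤ quadratic H x₀ v y := by
  rw [quadratic_expansion H x₀ v (x₀ - H⁻¹ • v) y]
  have h : H • (x₀ - H⁻¹ • v - x₀) + v = 0 := by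
    rw [sub_sub_cancel_left, smul_neg, smul_smul, mul_inv_cancel₀ hH.ne', one_smul,
      neg_add_cancel]
  rw [h, inner_zero_left]
  have : 0 ≤ H / 2 * ‖y - (x₀ - H⁻¹ • v)‖ ^ 2 := by positivity
  linarith

variable [CompleteSpace E]

theorem hasGradientAt_quadratic (H : ℝ) (x₀ v x : E) :
    HasGradientAt (quadratic H x₀ v) (H • (x - x₀) + v) x := by
  rw [hasGradientAt_iff_hasFDerivAt]
  have h₀ : HasFDerivAt (fun y : E => y - x₀) (ContinuousLinearMap.id ℝ E) x :=
    (hasFDerivAt_id x).sub_const x₀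
  have h₁ := (h₀.norm_sq.const_mul (H / 2)).add ((innerSL ℝ v).hasFDerivAt.comp x h₀)
  refine h₁.congr_fderiv ?_
  ext w
  simp
  ring

theorem gradient_quadratic (H : ℝ) (x₀ v x : E) :
    gradient (quadratic H x₀ v) x = H • (x - x₀) + v :=
  (hasGradientAt_quadratic H x₀ v x).gradient

theorem differentiable_quadratic (H : ℝ) (x₀ v : E) : Differentiable ℝ (quadratic H x₀ v) :=
  fun x => (hasGradientAt_quadratic H x₀ v x).differentiableAt

theorem isSmooth_quadratic (H : ℝ) (x₀ v : E) : IsSmooth H (quadratic H x₀ v) :=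
  ⟨differentiable_quadratic H x₀ v, fun x y => by
    rw [gradient_quadratic, quadratic_expansion H x₀ v x y]⟩

theorem isStronglyConvex_quadratic {H : ℝ} (hH : 0 ≤ H) (x₀ v : E) :
    IsStronglyConvex 0 (quadratic H x₀ v) :=
  ⟨differentiable_quadratic H x₀ v, fun x y => by
    rw [gradient_quadratic, quadratic_expansion H x₀ v x y]
    have : 0 ≤ H / 2 * ‖y - x‖ ^ 2 := by positivity
    linarith⟩

theorem quadratic_mem_domainBounded {H R : ℝ} (hH : 0 < H) (x₀ : E) {v : E}
    (hv : ‖v‖ ≤ H * R) : quadratic H x₀ v ∈ domainBounded H 0 R x₀ := by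
  refine ⟨isSmooth_quadratic H x₀ v, isStronglyConvex_quadratic hH.le x₀ v, x₀ - H⁻¹ • v,
    quadratic_minimizer_le hH x₀ v, ?_⟩
  rw [sub_sub_cancel, norm_smul, norm_inv, Real.norm_of_nonneg hH.le]
  exact (inv_mul_le_iff₀ hH).2 hv

theorem quadratic_mem_rangeBounded {H Δ : ℝ} (hH : 0 < H) (x₀ : E) {v : E}
    (hv : ‖v‖ ^ 2 ≤ 2 * H * Δ) : quadratic H x₀ v ∈ rangeBounded H 0 Δ x₀ := by
  refine ⟨isSmooth_quadratic H x₀ v, isStronglyConvex_quadratic hH.le x₀ v, x₀ - H⁻¹ • v,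
    quadratic_minimizer_le hH x₀ v, ?_⟩
  have h : quadratic H x₀ v x₀ - quadratic H x₀ v (x₀ - H⁻¹ • v) = ‖v‖ ^ 2 / (2 * H) := by
    simp only [quadratic, sub_self, sub_sub_cancel_left, norm_neg, norm_zero, inner_zero_right,
      inner_neg_right, norm_smul, norm_inv, real_inner_smul_right, real_inner_self_eq_norm_sq,
      Real.norm_of_nonneg hH.le]
    field_simp
    ring
  rw [h, div_le_iff₀ (by positivity)]
  linarith

end Quadratic

/-! ### Biased coins -/

section Coin

/-- The probability of `b` under a coin with bias `δ`. -/
def coinWeight (δ : ℝ) (b : Bool) : ℝ := (1 + (if b then 1 else -1) * δ) / 2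

theorem coinWeight_nonneg {δ : ℝ} (hδ : |δ| ≤ 1) (b : Bool) : 0 ≤ coinWeight δ b := by
  obtain ⟨h₁, h₂⟩ := abs_le.1 hδ
  cases b <;> simp [coinWeight] <;> linarith

/-- The law of a coin with bias `δ`. -/
def coin (δ : ℝ) : Measure Bool :=
  ENNReal.ofReal (coinWeight δ true) • Measure.dirac true +
    ENNReal.ofReal (coinWeight δ false) • Measure.dirac false

theorem coin_singleton (δ : ℝ) (b : Bool) : coin δ {b} = ENNReal.ofReal (coinWeight δ b) := by
  cases b <;> simp [coin]

theorem isProbabilityMeasure_coin {δ : ℝ} (hδ : |δ| ≤ 1) : IsProbabilityMeasure (coin δ) := by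
  refine ⟨?_⟩
  simp only [coin, Measure.add_apply, Measure.smul_apply, measure_univ, smul_eq_mul, mul_one]
  rw [← ENNReal.ofReal_add (coinWeight_nonneg hδ _) (coinWeight_nonneg hδ _)]
  simp [coinWeight]
  ring

theorem lintegral_coin (δ : ℝ) (g : Bool → ℝ≥0∞) :
    ∫⁻ b, g b ∂coin δ = ENNReal.ofReal (coinWeight δ true) * g true +
      ENNReal.ofReal (coinWeight δ false) * g false := by
  simp [coin, lintegral_add_measure]

theorem integral_coin {δ : ℝ} (hδ : |δ| ≤ 1) (g : Bool → ℝ) :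
    ∫ b, g b ∂coin δ = coinWeight δ true * g true + coinWeight δ false * g false := by
  have := isProbabilityMeasure_coin hδ
  rw [integral_fintype Integrable.of_finite]
  simp [measureReal_def, coin_singleton, ENNReal.toReal_ofReal, coinWeight_nonneg hδ]

/-- The probability of `z` under independent coins with bias `δ`. -/
def coinsWeight (δ : ℝ) {m : ℕ} (z : Fin m → Bool) : ℝ := ∏ i, coinWeight δ (z i)

theorem coinsWeight_nonneg {δ : ℝ} (hδ : |δ| ≤ 1) {m : ℕ} (z : Fin m → Bool) :
    0 ≤ coinsWeight δ z :=
  Finset.prod_nonneg fun _ _ => coinWeight_nonneg hδ _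

theorem sum_coinsWeight (δ : ℝ) (m : ℕ) : ∑ z : Fin m → Bool, coinsWeight δ z = 1 := by
  simp only [coinsWeight]
  rw [← Fintype.prod_sum fun (_ : Fin m) b => coinWeight δ b]
  refine Finset.prod_eq_one fun _ _ => ?_
  simp [coinWeight]
  ring

theorem lintegral_pi_coin {δ : ℝ} (hδ : |δ| ≤ 1) {m : ℕ} (g : (Fin m → Bool) → ℝ≥0∞) :
    ∫⁻ z, g z ∂(Measure.pi fun _ : Fin m => coin δ) =
      ∑ z, g z * ENNReal.ofReal (coinsWeight δ z) := by
  have := isProbabilityMeasure_coin hδ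
  rw [lintegral_fintype]
  refine Finset.sum_congr rfl fun z _ => ?_
  rw [Measure.pi_singleton, coinsWeight,
    ENNReal.ofReal_prod_of_nonneg fun i _ => coinWeight_nonneg hδ _]
  simp [coin_singleton]

/-- This is the Bhattacharyya coefficient of the two laws. The product of the two weights is `(1 -
δ²) / 4` for either face, so all `2 ^ m` terms are equal. -/
theorem sum_sqrt_coinsWeight {δ : ℝ} (hδ : |δ| ≤ 1) (m : ℕ) :
    ∑ z : Fin m → Bool, √(coinsWeight δ z * coinsWeight (-δ) z) = √(1 - δ ^ 2) ^ m := by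
  have h : ∀ b, coinWeight δ b * coinWeight (-δ) b = (1 - δ ^ 2) / 4 := by
    intro b
    cases b <;> simp [coinWeight] <;> ring
  have h₀ : 0 ≤ (1 - δ ^ 2) / 4 := by
    have := (sq_le_one_iff_abs_le_one δ).2 hδ
    linarith
  have h₄ : √((1 - δ ^ 2) / 4) = √(1 - δ ^ 2) / 2 := by
    rw [Real.sqrt_div' _ (by norm_num), show (4 : ℝ) = 2 ^ 2 by norm_num,
      Real.sqrt_sq (by norm_num)]
  have h₁ : ∀ z : Fin m → Bool,
      √(coinsWeight δ z * coinsWeight (-δ) z) = (√(1 - δ ^ 2) / 2) ^ m := by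
    intro z
    rw [coinsWeight, coinsWeight, ← Finset.prod_mul_distrib]
    simp only [h, Finset.prod_const, Finset.card_univ, Fintype.card_fin]
    rw [← h₄, Real.sqrt_eq_iff_mul_self_eq (by positivity) (by positivity), ← mul_pow,
      Real.mul_self_sqrt h₀]
  simp only [h₁, Finset.sum_const, Finset.card_univ, Fintype.card_fun, Fintype.card_bool,
    Fintype.card_fin, nsmul_eq_mul]
  push_cast
  rw [← mul_pow, mul_div_cancel₀ _ two_ne_zero]

/-- The laws of `m` flips of coins with biases `δ` and `-δ` have overlap at least
`(1 - m δ²) / 2`. -/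
theorem sum_min_coinsWeight_ge {δ : ℝ} (hδ : |δ| ≤ 1) (m : ℕ) :
    (1 - m * δ ^ 2) / 2 ≤
      ∑ z : Fin m → Bool, min (coinsWeight δ z) (coinsWeight (-δ) z) := by
  have hδ' : |-δ| ≤ 1 := by rwa [abs_neg]
  have hsq : δ ^ 2 ≤ 1 := (sq_le_one_iff_abs_le_one δ).2 hδ
  -- Cauchy–Schwarz with `p q = min p q * max p q`: the squared Bhattacharyya coefficient is at most
  -- `(∑ min) * (∑ max)`, and `∑ max ≤ 2`.
  have hcs := Finset.sum_sq_le_sum_mul_sum_of_sq_le_mul (Finset.univ : Finset (Fin m → Bool))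
    (r := fun z => √(coinsWeight δ z * coinsWeight (-δ) z))
    (f := fun z => min (coinsWeight δ z) (coinsWeight (-δ) z))
    (g := fun z => max (coinsWeight δ z) (coinsWeight (-δ) z))
    (fun z _ => le_min (coinsWeight_nonneg hδ z) (coinsWeight_nonneg hδ' z))
    (fun z _ => le_max_of_le_left (coinsWeight_nonneg hδ z))
    (fun z _ => by
      rw [Real.sq_sqrt (mul_nonneg (coinsWeight_nonneg hδ z) (coinsWeight_nonneg hδ' z)),
        min_mul_max])
  rw [sum_sqrt_coinsWeight hδ, ← pow_mul, mul_comm m 2, pow_mul,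
    Real.sq_sqrt (by linarith)] at hcs
  -- Bernoulli's inequality: `1 - m δ² ≤ (1 - δ²) ^ m`.
  have hbern := one_add_mul_le_pow (a := -δ ^ 2) (by linarith) m
  have hmin : 0 ≤ ∑ z : Fin m → Bool, min (coinsWeight δ z) (coinsWeight (-δ) z) :=
    Finset.sum_nonneg fun z _ => le_min (coinsWeight_nonneg hδ z) (coinsWeight_nonneg hδ' z)
  have hmax : ∑ z : Fin m → Bool, max (coinsWeight δ z) (coinsWeight (-δ) z) ≤ 2 := by
    calc _ ≤ ∑ z : Fin m → Bool, (coinsWeight δ z + coinsWeight (-δ) z) :=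
          Finset.sum_le_sum fun z _ =>
            max_le_add_of_nonneg (coinsWeight_nonneg hδ z) (coinsWeight_nonneg hδ' z)
      _ = 2 := by
          rw [Finset.sum_add_distrib, sum_coinsWeight, sum_coinsWeight]
          norm_num
  have := mul_le_mul_of_nonneg_left hmax hmin
  rw [← sub_eq_add_neg] at hbern
  linarith

end Coin

/-! ### The coin oracle of a quadratic function -/

section CoinOracle

variable {E : Type*} [NormedAddCommGroup E] [InnerProductSpace ℝ E]

/-- The oracle that flips a coin with bias `δ` and returns the quadratic function with linear
part `v` or `-v`. -/
def coinOracle (H : ℝ) (x₀ v : E) {δ : ℝ} (hδ : |δ| ≤ 1) : StochasticOracle E (E → ℝ) where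
  Z := Bool
  D := coin δ
  instIsProbabilityMeasure := isProbabilityMeasure_coin hδ
  answer _ b := quadratic H x₀ ((if b then 1 else -1 : ℝ) • v)

/-- The answers of the coin oracle depend on neither the queries nor the bias. -/
theorem iterate_coinOracle_eq (A : List (E → ℝ) → E) (H : ℝ) (x₀ v : E) {δ δ' : ℝ}
    (hδ : |δ| ≤ 1) (hδ' : |δ'| ≤ 1) {m : ℕ} (z : Fin m → Bool) :
    iterate A (coinOracle H x₀ v hδ) z = iterate A (coinOracle H x₀ v hδ') z := rfl

variable [CompleteSpace E]

/-- The random sign has mean `δ` and variance `1 - δ²`, so the mean linear part is `δ • v` and the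
gradient variance is `(1 - δ²) ‖v‖² ≤ σ²` at every point. -/
theorem coinOracle_mem_globalOracles (H : ℝ) (x₀ : E) {v : E} {σ δ : ℝ} (hv : ‖v‖ ≤ σ)
    (hδ : |δ| ≤ 1) :
    coinOracle H x₀ v hδ ∈ globalOracles σ (quadratic H x₀ (δ • v)) := by
  have := isProbabilityMeasure_coin hδ
  refine ⟨fun x (b : Bool) => quadratic H x₀ ((if b then 1 else -1 : ℝ) • v) x,
    fun b => differentiable_quadratic _ _ _, fun x => measurable_from_top (α := Bool),
    fun x => Integrable.of_finite (α := Bool) (μ := coin δ), fun x => ?_, fun x => ?_,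
    fun _ _ => rfl⟩
  · refine Eq.trans ?_ (integral_coin hδ _).symm
    simp [quadratic, coinWeight, real_inner_smul_left]
    ring
  · refine (lintegral_coin δ _).trans_le ?_
    have hnorm : ∀ b : Bool, ‖gradient (quadratic H x₀ ((if b then 1 else -1 : ℝ) • v)) x -
        gradient (quadratic H x₀ (δ • v)) x‖ₑ ^ 2 =
          ENNReal.ofReal (((if b then 1 else -1) - δ) ^ 2 * ‖v‖ ^ 2) := by
      intro b
      rw [gradient_quadratic, gradient_quadratic, add_sub_add_left_eq_sub, ← sub_smul,
        ← ofReal_norm, ← ENNReal.ofReal_pow (norm_nonneg _), norm_smul, mul_pow,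
        Real.norm_eq_abs, sq_abs]
    refine (congrArg₂ _ (congrArg _ (hnorm true)) (congrArg _ (hnorm false))).trans_le ?_
    rw [← ENNReal.ofReal_mul (coinWeight_nonneg hδ _),
      ← ENNReal.ofReal_mul (coinWeight_nonneg hδ _), ← ENNReal.ofReal_add
        (mul_nonneg (coinWeight_nonneg hδ _) (by positivity))
        (mul_nonneg (coinWeight_nonneg hδ _) (by positivity))]
    refine ENNReal.ofReal_le_ofReal ?_
    have hvar : coinWeight δ true * (((if true then 1 else -1) - δ) ^ 2 * ‖v‖ ^ 2) +
        coinWeight δ false * (((if false then 1 else -1) - δ) ^ 2 * ‖v‖ ^ 2) =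
          ‖v‖ ^ 2 - δ ^ 2 * ‖v‖ ^ 2 := by
      simp [coinWeight]
      ring
    have h₁ : 0 ≤ δ ^ 2 * ‖v‖ ^ 2 := by positivity
    have h₂ : ‖v‖ ^ 2 ≤ σ ^ 2 := pow_le_pow_left₀ (norm_nonneg v) hv 2
    exact hvar.trans_le (by linarith)

theorem coinOracle_mem_convexGlobalOracles {H : ℝ} (hH : 0 ≤ H) (x₀ : E) {v : E} {σ δ : ℝ}
    (hv : ‖v‖ ≤ σ) (hδ : |δ| ≤ 1) :
    coinOracle H x₀ v hδ ∈ convexGlobalOracles σ (quadratic H x₀ (δ • v)) :=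
  ⟨coinOracle_mem_globalOracles H x₀ hv hδ, fun _ _ => convexOn_quadratic hH _ _⟩

theorem expectedGradNorm_coinOracle (A : List (E → ℝ) → E) (H : ℝ) (x₀ v : E) {δ : ℝ}
    (hδ : |δ| ≤ 1) (F : E → ℝ) (m : ℕ) :
    expectedGradNorm A (coinOracle H x₀ v hδ) F m =
      ∑ z : Fin m → Bool, ‖gradient F (iterate A (coinOracle H x₀ v hδ) z)‖ₑ *
        ENNReal.ofReal (coinsWeight δ z) :=
  lintegral_pi_coin hδ _

/-- No point is nearly stationary for both quadratic functions. -/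
theorem gradient_norm_add_ge (H : ℝ) (x₀ w x : E) :
    ENNReal.ofReal (2 * ‖w‖) ≤
      ‖gradient (quadratic H x₀ w) x‖ₑ + ‖gradient (quadratic H x₀ (-w)) x‖ₑ := by
  rw [gradient_quadratic, gradient_quadratic, ← ofReal_norm, ← ofReal_norm,
    ← ENNReal.ofReal_add (norm_nonneg _) (norm_nonneg _)]
  refine ENNReal.ofReal_le_ofReal ?_
  have h := norm_sub_le (H • (x - x₀) + w) (H • (x - x₀) + -w)
  rwa [add_sub_add_left_eq_sub, sub_neg_eq_add, ← two_smul ℝ w, norm_smul, Real.norm_two] at h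

/-- Two-point lower bound: an algorithm cannot tell the biases `δ` and `-δ` apart. -/
theorem expectedGradNorm_add_ge (A : List (E → ℝ) → E) (H : ℝ) (x₀ v : E) {δ : ℝ}
    (hδ : |δ| ≤ 1) (hδ' : |-δ| ≤ 1) (m : ℕ) :
    ENNReal.ofReal ((1 - m * δ ^ 2) * ‖δ • v‖) ≤
      expectedGradNorm A (coinOracle H x₀ v hδ) (quadratic H x₀ (δ • v)) m +
        expectedGradNorm A (coinOracle H x₀ v hδ') (quadratic H x₀ (-δ • v)) m := by
  rw [expectedGradNorm_coinOracle, expectedGradNorm_coinOracle, ← Finset.sum_add_distrib]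
  calc ENNReal.ofReal ((1 - m * δ ^ 2) * ‖δ • v‖)
      ≤ ENNReal.ofReal (∑ z : Fin m → Bool,
          2 * ‖δ • v‖ * min (coinsWeight δ z) (coinsWeight (-δ) z)) := by
        refine ENNReal.ofReal_le_ofReal ?_
        rw [← Finset.mul_sum]
        have := mul_le_mul_of_nonneg_left (sum_min_coinsWeight_ge hδ m)
          (by positivity : 0 ≤ 2 * ‖δ • v‖)
        linarith
    _ = ∑ z : Fin m → Bool, ENNReal.ofReal (2 * ‖δ • v‖) *
          ENNReal.ofReal (min (coinsWeight δ z) (coinsWeight (-δ) z)) := by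
        rw [ENNReal.ofReal_sum_of_nonneg fun z _ => mul_nonneg (by positivity)
          (le_min (coinsWeight_nonneg hδ z) (coinsWeight_nonneg hδ' z))]
        exact Finset.sum_congr rfl fun z _ => ENNReal.ofReal_mul (by positivity)
    _ ≤ _ := by
        refine Finset.sum_le_sum fun z _ => ?_
        -- For fixed flips both runs end at the same point, so the smaller weight can multiply the
        -- sum of the two gradient norms there.
        rw [iterate_coinOracle_eq A H x₀ v hδ' hδ z, neg_smul]
        refine (mul_le_mul_left (gradient_norm_add_ge H x₀ (δ • v)
          (iterate A (coinOracle H x₀ v hδ) z)) _).trans ?_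
        rw [add_mul]
        gcongr
        · exact min_le_left _ _
        · exact min_le_right _ _

variable [MeasurableSpace E]

/-- Tonelli reduces the randomized risk to the deterministic one. Joint measurability holds because
there are finitely many flip sequences, so it suffices to fix one. -/
theorem randomizedExpectedGradNorm_coinOracle [BorelSpace E]
    (A : RandomizedAlgorithm.{u} E (E → ℝ))
    (H : ℝ) (x₀ v : E) {δ : ℝ} (hδ : |δ| ≤ 1) (w : E) (m : ℕ) :
    Measurable (fun s => expectedGradNorm (A.alg s) (coinOracle H x₀ v hδ)
      (quadratic H x₀ w) m) ∧
    randomizedExpectedGradNorm A (coinOracle H x₀ v hδ) (quadratic H x₀ w) m =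
      ∫⁻ s, expectedGradNorm (A.alg s) (coinOracle H x₀ v hδ) (quadratic H x₀ w) m ∂A.P := by
  have := isProbabilityMeasure_coin hδ
  have hcont : Continuous fun x => ‖gradient (quadratic H x₀ w) x‖ₑ := by
    simp only [gradient_quadratic]
    fun_prop
  have hmeas : Measurable fun p : A.Ω × (Fin m → Bool) =>
      ‖gradient (quadratic H x₀ w) (iterate (A.alg p.1) (coinOracle H x₀ v hδ) p.2)‖ₑ := by
    refine measurable_from_prod_countable_left fun z => hcont.measurable.comp ?_
    -- The answers ignore the queries, so the transcript is the same list for every seed and any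
    -- algorithm, here a constant one, can be used to write it.
    exact A.measurable_alg (transcript (fun _ => x₀) (coinOracle H x₀ v hδ) (List.ofFn z))
  exact ⟨hmeas.lintegral_prod_right' (ν := Measure.pi fun _ : Fin m => coin δ),
    lintegral_prod (ν := Measure.pi fun _ : Fin m => coin δ) _ hmeas.aemeasurable⟩

theorem randomizedExpectedGradNorm_add_ge [BorelSpace E]
    (A : RandomizedAlgorithm.{u} E (E → ℝ))
    (H : ℝ) (x₀ v : E) {δ : ℝ} (hδ : |δ| ≤ 1) (hδ' : |-δ| ≤ 1) (m : ℕ) :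
    ENNReal.ofReal ((1 - m * δ ^ 2) * ‖δ • v‖) ≤
      randomizedExpectedGradNorm A (coinOracle H x₀ v hδ) (quadratic H x₀ (δ • v)) m +
        randomizedExpectedGradNorm A (coinOracle H x₀ v hδ') (quadratic H x₀ (-δ • v)) m := by
  obtain ⟨hm, h₁⟩ := randomizedExpectedGradNorm_coinOracle A H x₀ v hδ (δ • v) m
  rw [h₁, (randomizedExpectedGradNorm_coinOracle A H x₀ v hδ' (-δ • v) m).2,
    ← lintegral_add_left hm]
  calc ENNReal.ofReal ((1 - m * δ ^ 2) * ‖δ • v‖)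
      = ∫⁻ _, ENNReal.ofReal ((1 - m * δ ^ 2) * ‖δ • v‖) ∂A.P := by simp
    _ ≤ _ := lintegral_mono fun s => expectedGradNorm_add_ge (A.alg s) H x₀ v hδ hδ' m

end CoinOracle

/-! ### Lower bounds on the complexity -/

section LowerBound

/-- If the risks of every algorithm at two instances add up to at least `(1 - m δ²) · 4ε`, then
a minimax risk of at most `ε` forces `m δ² ≥ 1/2`. -/
theorem half_le_of_iInf_iSup_le {α β γ : Type*} {𝓕 : Set β} {𝓞 : β → Set γ}
    {risk : α → β → γ → ℝ≥0∞} {F₁ F₂ : β} {O₁ O₂ : γ} (hF₁ : F₁ ∈ 𝓕) (hF₂ : F₂ ∈ 𝓕)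
    (hO₁ : O₁ ∈ 𝓞 F₁) (hO₂ : O₂ ∈ 𝓞 F₂) {ε t : ℝ} (hε : 0 < ε)
    (hrisk : ∀ A, ENNReal.ofReal ((1 - t) * (4 * ε)) ≤ risk A F₁ O₁ + risk A F₂ O₂)
    (h : ⨅ A, ⨆ F ∈ 𝓕, ⨆ O ∈ 𝓞 F, risk A F O ≤ ENNReal.ofReal ε) : 1 / 2 ≤ t := by
  by_contra! ht
  -- The half-sum of the two risks bounds the supremum from below for each algorithm, so the infimum
  -- need not be attained.
  have hle : ENNReal.ofReal ((1 - t) * (4 * ε)) / 2 ≤ ENNReal.ofReal ε := by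
    refine (le_iInf fun A => ENNReal.div_le_of_le_mul ?_).trans h
    rw [mul_two]
    exact (hrisk A).trans (add_le_add
      (le_iSup₂_of_le F₁ hF₁ (le_iSup₂_of_le O₁ hO₁ le_rfl))
      (le_iSup₂_of_le F₂ hF₂ (le_iSup₂_of_le O₂ hO₂ le_rfl)))
  rw [← ENNReal.ofReal_ofNat 2, ← ENNReal.ofReal_div_of_pos two_pos,
    ENNReal.ofReal_le_ofReal_iff hε.le] at hle
  nlinarith

/-- Rounding `r` up to `⌈r⌉₊` moves the comparison into `ℕ∞`, where it also covers an infimum equal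
to `⊤`. -/
theorem ofReal_le_iInf_natCast {p : ℕ → Prop} {r : ℝ} (h : ∀ m, p m → r ≤ m) :
    ENNReal.ofReal r ≤ ((⨅ (m : ℕ) (_ : p m), (m : ℕ∞) : ℕ∞) : ℝ≥0∞) := by
  have hceil : ((⌈r⌉₊ : ℕ) : ℕ∞) ≤ ⨅ (m : ℕ) (_ : p m), (m : ℕ∞) :=
    le_iInf₂ fun m hm => Nat.cast_le.2 (Nat.ceil_le.2 (h m hm))
  refine le_trans ?_ (ENat.toENNReal_le.2 hceil)
  rw [ENat.toENNReal_coe, ← ENNReal.ofReal_natCast]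
  exact ENNReal.ofReal_le_ofReal (Nat.le_ceil r)

variable {E : Type*} [NormedAddCommGroup E] [InnerProductSpace ℝ E] [CompleteSpace E]
  [MeasurableSpace E] [BorelSpace E]

/-- Lower bound for every class of oracles that contains the coin oracles. -/
theorem le_complexity_of_coinOracle_mem {x₀ v : E} {H ε δ : ℝ} {𝓕 : Set (E → ℝ)}
    {𝓞 : (E → ℝ) → Set (StochasticOracle E (E → ℝ))} (hε : 0 < ε) (hδ₀ : δ ≠ 0)
    (hδ : |δ| ≤ 1) (hv : ‖δ • v‖ = 4 * ε)
    (h𝓕 : ∀ w : E, ‖w‖ = 4 * ε → quadratic H x₀ w ∈ 𝓕)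
    (h𝓞 : ∀ (θ : ℝ) (hθ : |θ| ≤ 1),
      coinOracle H x₀ v hθ ∈ 𝓞 (quadratic H x₀ (θ • v))) :
    ENNReal.ofReal (1 / (2 * δ ^ 2)) ≤ (complexity 𝓕 𝓞 ε : ℝ≥0∞) ∧
      ENNReal.ofReal (1 / (2 * δ ^ 2)) ≤ (randomizedComplexity.{u} 𝓕 𝓞 ε : ℝ≥0∞) := by
  have hδ' : |-δ| ≤ 1 := by rwa [abs_neg]
  have hv' : ‖-δ • v‖ = 4 * ε := by rwa [neg_smul, norm_neg]
  have hδ₂ : 0 < δ ^ 2 := by positivity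
  have hm : ∀ m : ℕ, 1 / 2 ≤ m * δ ^ 2 → 1 / (2 * δ ^ 2) ≤ m := fun m h => by
    rw [div_le_iff₀ (by positivity)]
    linarith
  constructor
  · refine ofReal_le_iInf_natCast fun m h => hm m ?_
    refine half_le_of_iInf_iSup_le (risk := fun A F O => expectedGradNorm A O F m)
      (h𝓕 _ hv) (h𝓕 _ hv') (h𝓞 δ hδ) (h𝓞 (-δ) hδ') hε (fun A => ?_) h
    rw [← hv]
    exact expectedGradNorm_add_ge A H x₀ v hδ hδ' m
  · refine ofReal_le_iInf_natCast fun m h => hm m ?_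
    refine half_le_of_iInf_iSup_le
      (risk := fun (A : RandomizedAlgorithm.{u} E (E → ℝ)) F O =>
        randomizedExpectedGradNorm A O F m)
      (h𝓕 _ hv) (h𝓕 _ hv') (h𝓞 δ hδ) (h𝓞 (-δ) hδ') hε (fun A => ?_) h
    rw [← hv]
    exact randomizedExpectedGradNorm_add_ge A H x₀ v hδ hδ' m

end LowerBound

end StochOpt

end

theorem mainTheorem4 :
    ∃ c : ℝ, 0 < c ∧
      ∀ (d : ℕ) (_ : 1 ≤ d) (x₀ : EuclideanSpace ℝ (Fin d)) (H Δ R σ ε : ℝ),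
        0 < H → 0 < Δ → 0 < R → 0 < σ → 0 < ε →
        ε ≤ min (H * R / 8) (min (Real.sqrt (H * Δ / 8)) (σ / 4)) →
        ENNReal.ofReal (c * (σ ^ 2 / ε ^ 2)) ≤
            (StochOpt.complexity
              (StochOpt.domainBounded H 0 R x₀ ∩ StochOpt.rangeBounded H 0 Δ x₀)
              (StochOpt.globalOracles σ) ε : ENNReal) ∧
        ENNReal.ofReal (c * (σ ^ 2 / ε ^ 2)) ≤
            (StochOpt.randomizedComplexity.{u}
              (StochOpt.domainBounded H 0 R x₀ ∩ StochOpt.rangeBounded H 0 Δ x₀)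
              (StochOpt.globalOracles σ) ε : ENNReal) ∧
        ENNReal.ofReal (c * (σ ^ 2 / ε ^ 2)) ≤
            (StochOpt.complexity
              (StochOpt.domainBounded H 0 R x₀ ∩ StochOpt.rangeBounded H 0 Δ x₀)
              (StochOpt.convexGlobalOracles σ) ε : ENNReal) ∧
        ENNReal.ofReal (c * (σ ^ 2 / ε ^ 2)) ≤
            (StochOpt.randomizedComplexity.{u}
              (StochOpt.domainBounded H 0 R x₀ ∩ StochOpt.rangeBounded H 0 Δ x₀)
              (StochOpt.convexGlobalOracles σ) ε : ENNReal) := by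
  -- The constant is that of `1 / (2δ²)` at `δ = 4ε/σ`.
  refine ⟨1 / 32, by norm_num, fun d hd x₀ H Δ R σ ε hH hΔ hR hσ hε hmin => ?_⟩
  obtain ⟨h₁, h₂₃⟩ := le_min_iff.1 hmin
  obtain ⟨h₂, h₃⟩ := le_min_iff.1 h₂₃
  have hsq : ε ^ 2 ≤ H * Δ / 8 := (Real.le_sqrt hε.le (by positivity)).1 h₂
  -- A vector of norm `σ` exists because `d ≥ 1` makes the space nontrivial.
  have := Fin.pos_iff_nonempty.1 hd
  obtain ⟨v, hv⟩ := exists_norm_eq (EuclideanSpace ℝ (Fin d)) hσ.le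
  have hδ : |4 * ε / σ| ≤ 1 := by
    rw [abs_of_pos (by positivity), div_le_one hσ]
    linarith
  have hδv : ‖(4 * ε / σ) • v‖ = 4 * ε := by
    rw [norm_smul, Real.norm_of_nonneg (by positivity), hv, div_mul_cancel₀ _ hσ.ne']
  -- For `‖w‖ = 4ε` the minimizer is at distance `4ε/H ≤ R/2` from `x₀`, and the gap at `x₀` is
  -- `8ε²/H ≤ Δ`.
  have h𝓕 : ∀ w : EuclideanSpace ℝ (Fin d), ‖w‖ = 4 * ε → StochOpt.quadratic H x₀ w ∈
      StochOpt.domainBounded H 0 R x₀ ∩ StochOpt.rangeBounded H 0 Δ x₀ := fun w hw =>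
    ⟨StochOpt.quadratic_mem_domainBounded hH x₀ (by rw [hw]; nlinarith),
      StochOpt.quadratic_mem_rangeBounded hH x₀ (by rw [hw]; linarith)⟩
  have hδ₀ : 4 * ε / σ ≠ 0 := by positivity
  have hc : 1 / 32 * (σ ^ 2 / ε ^ 2) = 1 / (2 * (4 * ε / σ) ^ 2) := by
    field_simp
    norm_num
  have hall := StochOpt.le_complexity_of_coinOracle_mem.{u} hε hδ₀ hδ hδv h𝓕
    fun _ hθ => StochOpt.coinOracle_mem_globalOracles H x₀ hv.le hθ
  have hconvex := StochOpt.le_complexity_of_coinOracle_mem.{u} hε hδ₀ hδ hδv h𝓕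
    fun _ hθ => StochOpt.coinOracle_mem_convexGlobalOracles hH.le x₀ hv.le hθ
  rw [hc]
  exact ⟨hall.1, hall.2, hconvex.1, hconvex.2⟩
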